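/- Let $\Bbbk$ be a field. A perm algebra over $\Bbbk$ is an associative (not necessarily unital) $\Bbbk$-algebra in which $abc=bac$ for all $a,b,c$. For a perm algebra $P$ with a derivation $d$ (a $\Bbbk$-linear map with $d(ab)=d(a)b+a\,d(b)$), put $a\succ b=d(a)\,b$; the algebras $(P,\succ)$ obtained in this way are called $\mathrm{DerPerm}_\succ$ algebras. The variety generated by the $\mathrm{DerPerm}_\succ$ algebras consists of all nonassociative $\Bbbk$-algebras $(A,\succ)$ that satisfy every polynomial identity holding in all $\mathrm{DerPerm}_\succ$ algebras. In any algebra with multiplication $\succ$ write $\langle a,b,c\rangle=(a\succ b)\succ c-a\succ(b\succ c)$, and call the algebra an SLC-algebra if it satisfies the identities $$x_1\succ(x_2\succ x_3)=x_2\succ(x_1\succ x_3),$$ $$\langle x_1,x_2\succ x_3,x_4\rangle-\langle x_1,x_3,x_2\succ x_4\rangle=0,$$ $$\langle x_1,x_2,x_3\rangle\succ x_4-\langle x_1,x_3,x_2\rangle\succ x_4=0.$$ Theorem. (1) A nonassociative $\Bbbk$-algebra belongs to the variety generated by the $\mathrm{DerPerm}_\succ$ algebras if and only if it is an SLC-algebra;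 that is, these three identities are defining identities of that variety. (2) For every set $X$ there is an algebra isomorphism from the free SLC-algebra $\mathrm{SLC}\langle X\rangle$ onto $\mathrm{DerPerm}_\succ\langle X\rangle$ which is the identity on $X$. Here $\mathrm{DerPerm}\langle X\rangle$ is the free perm algebra with a derivation generated by $X$, and $\mathrm{DerPerm}_\succ\langle X\rangle$ is the subalgebra of $(\mathrm{DerPerm}\langle X\rangle,\succ)$ generated by $X$. -/

import Mathlib

universe u v w z

noncomputable section

namespace DerPerm

/-! ### Perm algebras with a derivation and the operation `a ≻ b = d(a) b` -/

/-- An associative algebra is a perm algebra if it is left-commutative: `a b c = b a c`. -/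
class IsPermAlgebra (P : Type*) [NonUnitalRing P] : Prop where
  left_comm : ∀ a b c : P, a * b * c = b * a * c

/-- A derivation of a (not necessarily commutative or unital) `k`-algebra: a `k`-linear map
satisfying the Leibniz rule. -/
structure PermDerivation (k : Type*) (P : Type*) [CommRing k] [NonUnitalRing P] [Module k P]
    extends P →ₗ[k] P where
  leibniz' : ∀ a b : P, toFun (a * b) = toFun a * b + a * toFun b

section Succ

variable {k : Type*} {P : Type*} [CommRing k] [NonUnitalRing P] [Module k P]

instance : CoeFun (PermDerivation k P) (fun _ => P → P) := ⟨fun d => d.toLinearMap⟩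

theorem PermDerivation.leibniz (d : PermDerivation k P) (a b : P) :
    d (a * b) = d a * b + a * d b := d.leibniz' a b

/-- The vector space `P` with the new multiplication `a ≻ b = d(a) b`. -/
def SuccAlgebra (_d : PermDerivation k P) : Type _ := P

namespace SuccAlgebra

variable (d : PermDerivation k P)

instance : AddCommGroup (SuccAlgebra d) := inferInstanceAs (AddCommGroup P)

instance : Module k (SuccAlgebra d) := inferInstanceAs (Module k P)

/-- An element of `P` viewed as an element of the algebra `(P, ≻)`. -/
def of : P ≃ₗ[k] SuccAlgebra d := LinearEquiv.refl k P

instance : Mul (SuccAlgebra d) where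
  mul a b := of d (d ((of d).symm a) * (of d).symm b)

theorem mul_def (a b : SuccAlgebra d) :
    a * b = of d (d ((of d).symm a) * (of d).symm b) := rfl

instance : NonUnitalNonAssocRing (SuccAlgebra d) :=
  { (inferInstance : AddCommGroup (SuccAlgebra d)),
    (inferInstance : Mul (SuccAlgebra d)) with
    left_distrib := fun a b c => by simp only [mul_def, map_add, mul_add]
    right_distrib := fun a b c => by simp only [mul_def, map_add, add_mul]
    zero_mul := fun a => by simp only [mul_def, map_zero, zero_mul]
    mul_zero := fun a => by simp only [mul_def, map_zero, mul_zero] }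

instance [IsScalarTower k P P] : IsScalarTower k (SuccAlgebra d) (SuccAlgebra d) where
  smul_assoc t a b := by simp only [smul_eq_mul, mul_def, map_smul, smul_mul_assoc]

instance [SMulCommClass k P P] : SMulCommClass k (SuccAlgebra d) (SuccAlgebra d) where
  smul_comm t a b := by simp only [smul_eq_mul, mul_def, map_smul, mul_smul_comm]

end SuccAlgebra

end Succ

/-! ### Identities and the variety generated by the `Der Perm_≻` algebras -/

/-- The `k`-algebra `A` satisfies the identity `f = 0`, where `f` is a nonassociative polynomial
in countably many variables: `f` vanishes under every substitution of elements of `A`. -/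
def Satisfies (k : Type*) [CommRing k] (A : Type*) [NonUnitalNonAssocRing A] [Module k A]
    [IsScalarTower k A A] [SMulCommClass k A A] (f : FreeNonUnitalNonAssocAlgebra k ℕ) : Prop :=
  ∀ s : ℕ → A, FreeNonUnitalNonAssocAlgebra.lift k s f = 0

/-- `f = 0` is an identity of all `Der Perm_≻` algebras, i.e. of `(P, ≻)` for every perm algebra
`P` with a derivation. -/
def IsSuccIdentity (k : Type u) [CommRing k] (f : FreeNonUnitalNonAssocAlgebra k ℕ) : Prop :=
  ∀ (P : Type (max u v)) [NonUnitalRing P] [Module k P] [IsScalarTower k P P]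
    [SMulCommClass k P P] [IsPermAlgebra P] (d : PermDerivation k P),
    Satisfies k (SuccAlgebra d) f

/-- `A` belongs to the variety generated by the `Der Perm_≻` algebras: it satisfies every
identity that holds in all of them. -/
def InSuccVariety (k : Type u) [CommRing k] (A : Type w) [NonUnitalNonAssocRing A] [Module k A]
    [IsScalarTower k A A] [SMulCommClass k A A] : Prop :=
  ∀ f : FreeNonUnitalNonAssocAlgebra k ℕ, IsSuccIdentity.{u, v} k f → Satisfies k A f

/-! ### SLC algebras -/

/-- Special left-commutative algebras; the multiplication of `A` is written `*` in place of `≻`,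
and `associator a b c = (a * b) * c - a * (b * c)`. -/
structure IsSLC (A : Type*) [NonUnitalNonAssocRing A] : Prop where
  left_comm : ∀ x₁ x₂ x₃ : A, x₁ * (x₂ * x₃) = x₂ * (x₁ * x₃)
  assoc_mul : ∀ x₁ x₂ x₃ x₄ : A,
    associator x₁ (x₂ * x₃) x₄ - associator x₁ x₃ (x₂ * x₄) = 0
  assoc_symm : ∀ x₁ x₂ x₃ x₄ : A,
    associator x₁ x₂ x₃ * x₄ - associator x₁ x₃ x₂ * x₄ = 0

section FreeSLC

variable (k : Type u) (X : Type v) [CommRing k]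

/-- The congruence on the free nonassociative algebra on `X` whose quotient is the free
SLC algebra. -/
inductive FreeSLC.Rel : FreeNonUnitalNonAssocAlgebra k X → FreeNonUnitalNonAssocAlgebra k X → Prop
  | left_comm (a b c : FreeNonUnitalNonAssocAlgebra k X) : Rel (a * (b * c)) (b * (a * c))
  | assoc_mul (a b c e : FreeNonUnitalNonAssocAlgebra k X) :
      Rel (associator a (b * c) e - associator a c (b * e)) 0
  | assoc_symm (a b c e : FreeNonUnitalNonAssocAlgebra k X) :
      Rel (associator a b c * e - associator a c b * e) 0
  | smul (t : k) {a b : FreeNonUnitalNonAssocAlgebra k X} : Rel a b → Rel (t • a) (t • b)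
  | add_right {a b : FreeNonUnitalNonAssocAlgebra k X} (c : FreeNonUnitalNonAssocAlgebra k X) :
      Rel a b → Rel (a + c) (b + c)
  | mul_left (a : FreeNonUnitalNonAssocAlgebra k X) {b c : FreeNonUnitalNonAssocAlgebra k X} :
      Rel b c → Rel (a * b) (a * c)
  | mul_right {a b : FreeNonUnitalNonAssocAlgebra k X} (c : FreeNonUnitalNonAssocAlgebra k X) :
      Rel a b → Rel (a * c) (b * c)

namespace FreeSLC

variable {k X}

theorem Rel.addLeft (a : FreeNonUnitalNonAssocAlgebra k X)
    {b c : FreeNonUnitalNonAssocAlgebra k X} (h : Rel k X b c) : Rel k X (a + b) (a + c) := by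
  rw [add_comm _ b, add_comm _ c]; exact h.add_right _

theorem Rel.neg {a b : FreeNonUnitalNonAssocAlgebra k X} (h : Rel k X a b) :
    Rel k X (-a) (-b) := by
  simpa only [neg_one_smul] using h.smul (-1)

theorem Rel.subLeft (a : FreeNonUnitalNonAssocAlgebra k X)
    {b c : FreeNonUnitalNonAssocAlgebra k X} (h : Rel k X b c) : Rel k X (a - b) (a - c) := by
  simpa only [sub_eq_add_neg] using h.neg.addLeft a

theorem Rel.subRight {a b : FreeNonUnitalNonAssocAlgebra k X}
    (c : FreeNonUnitalNonAssocAlgebra k X) (h : Rel k X a b) : Rel k X (a - c) (b - c) := by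
  simpa only [sub_eq_add_neg] using h.add_right (-c)

theorem Rel.smulOfTower {S : Type*} [Monoid S] [DistribMulAction S k] [IsScalarTower S k k] (t : S)
    (a b : FreeNonUnitalNonAssocAlgebra k X) (h : Rel k X a b) : Rel k X (t • a) (t • b) := by
  rw [← smul_one_smul k t a, ← smul_one_smul k t b]
  exact h.smul _

end FreeSLC

/-- The free SLC algebra on `X`. -/
def FreeSLC : Type _ := Quot (FreeSLC.Rel k X)

namespace FreeSLC

instance {S : Type*} [Monoid S] [DistribMulAction S k] [IsScalarTower S k k] :
    SMul S (FreeSLC k X) where smul t := Quot.map (t • ·) (Rel.smulOfTower t)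

instance : Zero (FreeSLC k X) where zero := Quot.mk _ 0

instance : Add (FreeSLC k X) where
  add := Quot.map₂ (· + ·) (fun _ _ _ => Rel.addLeft _) fun _ _ _ => Rel.add_right _

instance : Neg (FreeSLC k X) where neg := Quot.map Neg.neg fun _ _ => Rel.neg

instance : Sub (FreeSLC k X) where
  sub := Quot.map₂ Sub.sub (fun _ _ _ => Rel.subLeft _) fun _ _ _ => Rel.subRight _

instance : Mul (FreeSLC k X) where
  mul := Quot.map₂ (· * ·) (fun _ _ _ => Rel.mul_left _) fun _ _ _ => Rel.mul_right _

instance : AddGroup (FreeSLC k X) :=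
  Function.Surjective.addGroup (Quot.mk _) Quot.mk_surjective rfl (fun _ _ => rfl)
    (fun _ => rfl) (fun _ _ => rfl) (fun _ _ => rfl) fun _ _ => rfl

instance : AddCommSemigroup (FreeSLC k X) :=
  Function.Surjective.addCommSemigroup (Quot.mk _) Quot.mk_surjective fun _ _ => rfl

instance : AddCommGroup (FreeSLC k X) :=
  { (inferInstance : AddGroup (FreeSLC k X)),
    (inferInstance : AddCommSemigroup (FreeSLC k X)) with }

instance : Module k (FreeSLC k X) :=
  Function.Surjective.module k ⟨⟨Quot.mk (Rel k X), rfl⟩, fun _ _ => rfl⟩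
    Quot.mk_surjective (fun _ _ => rfl)

instance : NonUnitalNonAssocRing (FreeSLC k X) :=
  { (inferInstance : AddCommGroup (FreeSLC k X)),
    (inferInstance : Mul (FreeSLC k X)) with
    left_distrib := by
      rintro ⟨a⟩ ⟨b⟩ ⟨c⟩; exact congrArg (Quot.mk (Rel k X)) (mul_add a b c)
    right_distrib := by
      rintro ⟨a⟩ ⟨b⟩ ⟨c⟩; exact congrArg (Quot.mk (Rel k X)) (add_mul a b c)
    zero_mul := by
      rintro ⟨a⟩; exact congrArg (Quot.mk (Rel k X)) (zero_mul a)
    mul_zero := by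
      rintro ⟨a⟩; exact congrArg (Quot.mk (Rel k X)) (mul_zero a) }

instance : IsScalarTower k (FreeSLC k X) (FreeSLC k X) where
  smul_assoc := by
    rintro t ⟨a⟩ ⟨b⟩; exact congrArg (Quot.mk (Rel k X)) (smul_mul_assoc t a b)

instance : SMulCommClass k (FreeSLC k X) (FreeSLC k X) where
  smul_comm := by
    rintro t ⟨a⟩ ⟨b⟩; exact congrArg (Quot.mk (Rel k X)) (mul_smul_comm t a b).symm

/-- The quotient map. -/
def mk : FreeNonUnitalNonAssocAlgebra k X →ₙₐ[k] FreeSLC k X where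
  toFun := Quot.mk (Rel k X)
  map_smul' _ _ := rfl
  map_zero' := rfl
  map_add' _ _ := rfl
  map_mul' _ _ := rfl

variable {X}

/-- The free generators. -/
def of (x : X) : FreeSLC k X := mk k X (FreeNonUnitalNonAssocAlgebra.of k x)

theorem isSLC : IsSLC (FreeSLC k X) where
  left_comm := by
    rintro ⟨a⟩ ⟨b⟩ ⟨c⟩; exact Quot.sound (Rel.left_comm a b c)
  assoc_mul := by
    rintro ⟨a⟩ ⟨b⟩ ⟨c⟩ ⟨e⟩; exact Quot.sound (Rel.assoc_mul a b c e)
  assoc_symm := by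
    rintro ⟨a⟩ ⟨b⟩ ⟨c⟩ ⟨e⟩; exact Quot.sound (Rel.assoc_symm a b c e)

/-- The universal property of the free SLC algebra. -/
theorem existsUnique_lift {A : Type*} [NonUnitalNonAssocRing A] [Module k A]
    [IsScalarTower k A A] [SMulCommClass k A A] (hA : IsSLC A) (s : X → A) :
    ∃! F : FreeSLC k X →ₙₐ[k] A, ∀ x, F (of k x) = s x := by
  set L := FreeNonUnitalNonAssocAlgebra.lift k s with hL
  have key : ∀ a b, Rel k X a b → L a = L b := by
    intro a b h
    induction h with
    | left_comm a b c => simp only [map_mul]; exact hA.left_comm _ _ _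
    | assoc_mul a b c e =>
      simpa only [associator, map_sub, map_mul, map_zero] using hA.assoc_mul (L a) (L b) (L c) (L e)
    | assoc_symm a b c e =>
      simpa only [associator, map_sub, map_mul, map_zero] using
        hA.assoc_symm (L a) (L b) (L c) (L e)
    | smul t _ ih => simp only [map_smul, ih]
    | add_right c _ ih => simp only [map_add, ih]
    | mul_left a _ ih => simp only [map_mul, ih]
    | mul_right c _ ih => simp only [map_mul, ih]
  refine ⟨{ toFun := Quot.lift L key
            map_smul' := by rintro t ⟨a⟩; exact map_smul L t a
            map_zero' := map_zero L
            map_add' := by rintro ⟨a⟩ ⟨b⟩; exact map_add L a b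
            map_mul' := by rintro ⟨a⟩ ⟨b⟩; exact map_mul L a b }, ?_, ?_⟩
  · intro x
    exact FreeNonUnitalNonAssocAlgebra.lift_of_apply k s x
  · intro G hG
    have : G.comp (mk k X) = L := by
      apply FreeNonUnitalNonAssocAlgebra.hom_ext
      intro x
      rw [hL, FreeNonUnitalNonAssocAlgebra.lift_of_apply]
      exact hG x
    ext a
    obtain ⟨a, rfl⟩ := Quot.mk_surjective a
    exact DFunLike.congr_fun this a

end FreeSLC

end FreeSLC

/-! ### The free perm algebra with a derivation -/

section FreeDerPerm

variable (k : Type u) (X : Type v) [CommRing k]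

/-- The free perm algebra with a derivation generated by `X`. The pair `(x, j)` stands for the
letter `x^{(j)}`. The monomial `y₁ ⋯ yₙ₋₁ yₙ`, which does not depend on the order of
`y₁, …, yₙ₋₁`, is the finitely supported function that takes the value `y₁ ⋯ yₙ₋₁` (a commutative
monomial) at the last letter `yₙ` and `0` elsewhere. -/
def FreeDerPerm : Type _ := (X × ℕ) →₀ MvPolynomial (X × ℕ) k

namespace FreeDerPerm

instance : AddCommGroup (FreeDerPerm k X) :=
  inferInstanceAs (AddCommGroup ((X × ℕ) →₀ MvPolynomial (X × ℕ) k))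

instance : Module (MvPolynomial (X × ℕ) k) (FreeDerPerm k X) :=
  inferInstanceAs (Module (MvPolynomial (X × ℕ) k) ((X × ℕ) →₀ MvPolynomial (X × ℕ) k))

instance : Module k (FreeDerPerm k X) :=
  inferInstanceAs (Module k ((X × ℕ) →₀ MvPolynomial (X × ℕ) k))

instance : IsScalarTower k (MvPolynomial (X × ℕ) k) (FreeDerPerm k X) :=
  inferInstanceAs (IsScalarTower k (MvPolynomial (X × ℕ) k)
    ((X × ℕ) →₀ MvPolynomial (X × ℕ) k))

variable {X}

/-- The element `p y` with `p` a commutative polynomial and `y` the last letter. -/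
def term (y : X × ℕ) (p : MvPolynomial (X × ℕ) k) : FreeDerPerm k X := Finsupp.single y p

variable (X)

/-- The map that forgets which letter is the last one. -/
def forget : FreeDerPerm k X →ₗ[MvPolynomial (X × ℕ) k] MvPolynomial (X × ℕ) k :=
  Finsupp.linearCombination (MvPolynomial (X × ℕ) k) MvPolynomial.X

/-- `(y₁ ⋯ yₙ) (z₁ ⋯ zₘ) = y₁ ⋯ yₙ z₁ ⋯ zₘ`, with last letter `zₘ`. -/
instance : Mul (FreeDerPerm k X) where
  mul a b := forget k X a • b

variable {k X}

theorem mul_def (a b : FreeDerPerm k X) : a * b = forget k X a • b := rfl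

theorem forget_mul (a b : FreeDerPerm k X) :
    forget k X (a * b) = forget k X a * forget k X b := by
  rw [mul_def, map_smul, smul_eq_mul]

variable (k X)

instance : NonUnitalRing (FreeDerPerm k X) :=
  { (inferInstance : AddCommGroup (FreeDerPerm k X)),
    (inferInstance : Mul (FreeDerPerm k X)) with
    left_distrib := fun a b c => by simp only [mul_def, smul_add]
    right_distrib := fun a b c => by simp only [mul_def, map_add, add_smul]
    zero_mul := fun a => by simp only [mul_def, map_zero, zero_smul]
    mul_zero := fun a => by simp only [mul_def, smul_zero]
    mul_assoc := fun a b c => by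
      rw [mul_def (a * b), forget_mul, mul_smul]; rfl }

instance : IsPermAlgebra (FreeDerPerm k X) where
  left_comm a b c := by rw [mul_def, mul_def (b * a), forget_mul, forget_mul, mul_comm]

instance : IsScalarTower k (FreeDerPerm k X) (FreeDerPerm k X) where
  smul_assoc t a b := by
    simp only [smul_eq_mul, mul_def]
    rw [LinearMap.map_smul_of_tower, smul_assoc]

instance : SMulCommClass k (FreeDerPerm k X) (FreeDerPerm k X) where
  smul_comm t a b := by
    simp only [smul_eq_mul, mul_def]
    rw [← algebraMap_smul (MvPolynomial (X × ℕ) k) t, ← algebraMap_smul (MvPolynomial (X × ℕ) k) t,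
      smul_comm]

/-- The derivation of the polynomial algebra with `x^{(j)} ↦ x^{(j+1)}`. -/
def polyDer : Derivation k (MvPolynomial (X × ℕ) k) (MvPolynomial (X × ℕ) k) :=
  MvPolynomial.mkDerivation k fun y => MvPolynomial.X (y.1, y.2 + 1)

/-- The `k`-linear map with `p y ↦ p' y + p y'`. -/
def derLin : FreeDerPerm k X →ₗ[k] FreeDerPerm k X :=
  Finsupp.lsum k fun y : X × ℕ =>
    (Finsupp.lsingle y ∘ₗ (polyDer k X : MvPolynomial (X × ℕ) k →ₗ[k] MvPolynomial (X × ℕ) k) +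
      Finsupp.lsingle (y.1, y.2 + 1) :
      MvPolynomial (X × ℕ) k →ₗ[k] ((X × ℕ) →₀ MvPolynomial (X × ℕ) k))

variable {k X}

theorem derLin_term (y : X × ℕ) (p : MvPolynomial (X × ℕ) k) :
    derLin k X (term k y p) = term k y (polyDer k X p) + term k (y.1, y.2 + 1) p := by
  simp only [derLin, term]
  erw [Finsupp.lsum_single]
  rfl

theorem smul_term (y : X × ℕ) (p q : MvPolynomial (X × ℕ) k) :
    p • term k y q = term k y (p * q) :=
  Finsupp.smul_single p y q

theorem forget_term (y : X × ℕ) (p : MvPolynomial (X × ℕ) k) :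
    forget k X (term k y p) = p * MvPolynomial.X y :=
  Finsupp.linearCombination_single _ _ _

theorem term_add (y : X × ℕ) (p q : MvPolynomial (X × ℕ) k) :
    term k y (p + q) = term k y p + term k y q :=
  Finsupp.single_add y p q

theorem induction_term {motive : FreeDerPerm k X → Prop} (a : FreeDerPerm k X)
    (zero : motive 0) (add : ∀ a b, motive a → motive b → motive (a + b))
    (single : ∀ y p, motive (term k y p)) : motive a :=
  Finsupp.induction_linear a zero add single

theorem forget_derLin (a : FreeDerPerm k X) :
    forget k X (derLin k X a) = polyDer k X (forget k X a) := by
  induction a using induction_term with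
  | zero => simp only [map_zero]
  | add a b ha hb => simp only [map_add, ha, hb]
  | single y p =>
    simp only [derLin_term, map_add, forget_term, Derivation.leibniz, smul_eq_mul]
    rw [polyDer, MvPolynomial.mkDerivation_X]
    ring

theorem derLin_smul (p : MvPolynomial (X × ℕ) k) (a : FreeDerPerm k X) :
    derLin k X (p • a) = polyDer k X p • a + p • derLin k X a := by
  induction a using induction_term with
  | zero => simp only [map_zero, smul_zero, add_zero]
  | add a b ha hb => simp only [map_add, smul_add, ha, hb]; abel
  | single y q =>
    simp only [smul_term, derLin_term, smul_add, Derivation.leibniz, smul_eq_mul, term_add]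
    rw [mul_comm q]; abel

variable (k X)

/-- The derivation `d` of the free perm algebra with a derivation, `d(x^{(j)}) = x^{(j+1)}`. -/
def der : PermDerivation k (FreeDerPerm k X) where
  toLinearMap := derLin k X
  leibniz' a b := by
    change derLin k X (a * b) = derLin k X a * b + a * derLin k X b
    rw [mul_def, derLin_smul, mul_def, mul_def, forget_derLin]

variable {X}

/-- The letter `x^{(j)}` as an element of the free perm algebra with a derivation. -/
def letter (y : X × ℕ) : FreeDerPerm k X := term k y 1

/-- The free generators. -/
def of (x : X) : FreeDerPerm k X := letter k (x, 0)

variable {k}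

theorem der_letter (y : X × ℕ) : der k X (letter k y) = letter k (y.1, y.2 + 1) := by
  change derLin k X (term k y 1) = _
  rw [derLin_term, Derivation.map_one_eq_zero, letter]
  simp only [term, Finsupp.single_zero]
  exact zero_add _

section Lift

open scoped IsMulCommutative

variable {P : Type w} [NonUnitalRing P] [Module k P] [SMulCommClass k P P] [IsPermAlgebra P]

/-- The left multiplications of a perm algebra commute, so polynomials in the letters act on it. -/
theorem exists_action (φ : X × ℕ → P) : ∃ α : MvPolynomial (X × ℕ) k →ₐ[k] Module.End k P,
    ∀ y, α (MvPolynomial.X y) = LinearMap.mulLeft k (φ y) := by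
  set S : Set (Module.End k P) := Set.range fun y => LinearMap.mulLeft k (φ y) with hS
  have hc : ∀ a ∈ S, ∀ b ∈ S, a * b = b * a := by
    rintro _ ⟨y, rfl⟩ _ ⟨z, rfl⟩
    ext w
    change φ y * (φ z * w) = φ z * (φ y * w)
    rw [← mul_assoc, IsPermAlgebra.left_comm, mul_assoc]
  have := Algebra.isMulCommutative_adjoin k hc
  refine ⟨(Algebra.adjoin k S).val.comp (MvPolynomial.aeval fun y =>
    (⟨LinearMap.mulLeft k (φ y), Algebra.subset_adjoin ⟨y, rfl⟩⟩ : Algebra.adjoin k S)), ?_⟩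
  intro y
  rw [AlgHom.comp_apply, MvPolynomial.aeval_X]
  rfl

variable [IsScalarTower k P P]

/-- The universal property of the free perm algebra with a derivation. -/
theorem existsUnique_lift (d : PermDerivation k P) (s : X → P) :
    ∃! F : FreeDerPerm k X →ₙₐ[k] P,
      (∀ a, F (der k X a) = d (F a)) ∧ ∀ x, F (of k x) = s x := by
  set φ : X × ℕ → P := fun y => (fun z => d z)^[y.2] (s y.1) with hφ
  have hφs : ∀ y : X × ℕ, φ (y.1, y.2 + 1) = d (φ y) := fun y =>
    Function.iterate_succ_apply' _ _ _
  obtain ⟨α, hα⟩ := exists_action (k := k) φ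
  have hmul : ∀ p z w, α p z * w = α p (z * w) := by
    intro p z w
    induction p using MvPolynomial.induction_on generalizing z with
    | C c =>
      rw [← MvPolynomial.algebraMap_eq, AlgHom.commutes]
      simp only [Module.algebraMap_end_apply, smul_mul_assoc]
    | add p q hp hq => simp only [map_add, LinearMap.add_apply, add_mul, hp, hq]
    | mul_X p y hp =>
      simp only [map_mul, Module.End.mul_apply, hp, hα, LinearMap.mulLeft_apply, mul_assoc]
  have hder : ∀ p z, d (α p z) = α (polyDer k X p) z + α p (d z) := by
    intro p z
    induction p using MvPolynomial.induction_on generalizing z with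
    | C c =>
      rw [← MvPolynomial.algebraMap_eq, AlgHom.commutes, Derivation.map_algebraMap]
      simp only [Module.algebraMap_end_apply, map_smul, map_zero, LinearMap.zero_apply, zero_add]
    | add p q hp hq => simp only [map_add, LinearMap.add_apply, hp, hq]; abel
    | mul_X p y hp =>
      have hX : polyDer k X (MvPolynomial.X y) = MvPolynomial.X (y.1, y.2 + 1) := by
        rw [polyDer, MvPolynomial.mkDerivation_X]
      rw [Derivation.leibniz, hX, smul_eq_mul, smul_eq_mul, mul_comm (MvPolynomial.X y)]
      simp only [map_add, map_mul, Module.End.mul_apply, hp, hα, LinearMap.mulLeft_apply,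
        PermDerivation.leibniz, hφs, LinearMap.add_apply]
      abel
  let F₀ : FreeDerPerm k X →ₗ[k] P := Finsupp.lsum k fun y : X × ℕ =>
    (LinearMap.applyₗ (φ y)).comp α.toLinearMap
  have hF₀ : ∀ y p, F₀ (term k y p) = α p (φ y) := by
    intro y p
    change Finsupp.lsum k _ (Finsupp.single y p) = _
    rw [Finsupp.lsum_single]
    rfl
  have hsm : ∀ p a, F₀ (p • a) = α p (F₀ a) := by
    intro p a
    induction a using induction_term with
    | zero => simp only [smul_zero, map_zero]
    | add a b ha hb => simp only [smul_add, map_add, ha, hb]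
    | single y q => simp only [smul_term, hF₀, map_mul, Module.End.mul_apply]
  have hforget : ∀ a w, α (forget k X a) w = F₀ a * w := by
    intro a w
    induction a using induction_term with
    | zero => simp only [map_zero, LinearMap.zero_apply, zero_mul]
    | add a b ha hb => simp only [map_add, LinearMap.add_apply, add_mul, ha, hb]
    | single y q =>
      simp only [forget_term, hF₀, map_mul, Module.End.mul_apply, hα, LinearMap.mulLeft_apply, hmul]
  refine ⟨{ toFun := F₀
            map_smul' := fun t a => map_smul F₀ t a
            map_zero' := map_zero F₀
            map_add' := map_add F₀
            map_mul' := fun a b => by rw [mul_def, hsm, hforget] }, ⟨?_, ?_⟩, ?_⟩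
  · intro a
    change F₀ (derLin k X a) = d (F₀ a)
    induction a using induction_term with
    | zero => simp only [map_zero]
    | add a b ha hb => simp only [map_add, ha, hb]
    | single y p => rw [derLin_term, map_add, hF₀, hF₀, hF₀, hder, hφs]
  · intro x
    change F₀ (term k (x, 0) 1) = s x
    rw [hF₀, map_one]
    rfl
  · rintro G ⟨hGd, hGs⟩
    have hlet : ∀ x j, G (letter k (x, j)) = φ (x, j) := by
      intro x j
      induction j with
      | zero => exact hGs x
      | succ j ih =>
        have h := der_letter (k := k) (x, j)
        rw [← h, hGd, ih]
        exact (hφs (x, j)).symm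
    have hG : ∀ a, G a = F₀ a := by
      intro a
      induction a using induction_term with
      | zero => simp only [map_zero]
      | add a b ha hb => simp only [map_add, ha, hb]
      | single y p =>
        induction p using MvPolynomial.induction_on with
        | C c =>
          have : term k y (MvPolynomial.C c) = c • letter k y := by
            rw [letter, ← algebraMap_smul (MvPolynomial (X × ℕ) k) c, smul_term, mul_one]
            rfl
          rw [this, map_smul, map_smul, hlet y.1 y.2]
          change c • φ y = c • F₀ (term k y 1)
          rw [hF₀, map_one]
          rfl
        | add p q hp hq => simp only [term_add, map_add, hp, hq]
        | mul_X p z hp =>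
          have : term k y (p * MvPolynomial.X z) = letter k z * term k y p := by
            rw [mul_def, letter, forget_term, smul_term, one_mul, mul_comm]
          rw [this, map_mul, hp, hlet z.1 z.2, mul_def, letter, forget_term, one_mul, hsm, hα]
          rfl
    ext a
    exact hG a

end Lift

end FreeDerPerm

/-- The algebra `Der Perm_≻⟨X⟩`: the subalgebra of `(Der Perm⟨X⟩, ≻)` generated by `X`. -/
def FreeDerPermSucc : NonUnitalSubalgebra k (SuccAlgebra (FreeDerPerm.der k X)) :=
  NonUnitalAlgebra.adjoin k
    (Set.range fun x : X => SuccAlgebra.of (FreeDerPerm.der k X) (FreeDerPerm.of k x))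

variable {X}

/-- The free generators of `Der Perm_≻⟨X⟩`. -/
def FreeDerPermSucc.of (x : X) : FreeDerPermSucc k X :=
  ⟨SuccAlgebra.of (FreeDerPerm.der k X) (FreeDerPerm.of k x),
    NonUnitalAlgebra.subset_adjoin k (Set.mem_range_self x)⟩

end FreeDerPerm

end DerPerm

end

/-!
Write `a'` for `d a`. In `(P, ≻)` the associator of `a`, `b`, `c` is `a'' b c`, and the three SLC
identities follow from the perm identity. The substance is the converse: the canonical map from the
free SLC algebra `A` on `X` to `(Der Perm⟨X⟩, ≻)` is injective (`FreeSLC.injective_of_map_of`).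
Both parts of the theorem follow from this.

Give `x⁽ʲ⁾` the weight `j - 1`. Elements obtained from `X` by `≻` are sums of `p x`, where `p` is a
commutative polynomial of weight zero and the last letter `x` carries no derivative. The inverse map
should be `p x ↦ Φ(p) x`, with `Φ(p)` an operator on `A` such that `Φ(a') b = a ≻ b`. To find `Φ`,
let `M` be the algebra of operators on `A` generated by the left multiplications `L a`. It is
commutative by the first identity. By the second, `T ↦ L (T a) - T L a`, which plays the role of
`T ↦ T' a`, is a derivation of `M` and is `M`-linear in `a` (`LeftMulPresentation.derFun_smul_left`,
`LeftMulPresentation.der`). With the third, both `(T' a)' b - a' (T' b)` and `(S' a) (T' b)` are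
symmetric in `a` and `b` (`LeftMulPresentation.der_der_sub_comm`,
`LeftMulPresentation.der_mul_der_comm`).

These two symmetries are all that is used about `M` from then on. A monomial of weight zero is a
product of blocks `x⁽ⁿ⁺¹⁾ y₁ ⋯ yₙ`, and the Leibniz rule, solved for its leading term, defines the
operator of a block by recursion on `n`; symmetry makes it independent of the order of the `yᵢ`
(`IsBlockSystem.exists_blockFamily`). Letters can be exchanged between two blocks without changing
the product of their operators, so a product of blocks depends only on its monomial
(`IsBlockFamily.prod_eq_prod`). Thus `Φ` is well defined, and it is multiplicative and compatible
with the derivations on the polynomials generated by blocks (`IsBlockFamily.eq_of_mem_graph`,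
`IsBlockFamily.der_mem_graph`). Hence `(p x) ≻ (q y) = (p' x + p x') q y` corresponds to
multiplication in `A`, and `p x ↦ Φ(p) x` is a left inverse.
-/

namespace DerPerm

/-! ### The multiplication algebra of an SLC algebra -/

section Multiplication

variable {k : Type*} {A : Type*} {M : Type*} [CommRing k]

/-- A faithful presentation of the left multiplications of `A`: a commutative algebra `M` acting
on `A`, generated by elements `toLin a` that act as `b ↦ a * b`. -/
structure LeftMulPresentation (k A M : Type*) [CommRing k] [NonUnitalNonAssocRing A] [Module k A]
    [CommRing M] [Algebra k M] [Module M A] where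
  /-- The element of `M` acting as the left multiplication by a given element. -/
  toLin : A →ₗ[k] M
  toLin_smul : ∀ a b, toLin a • b = a * b
  faithful : ∀ S T : M, (∀ a : A, S • a = T • a) → S = T
  adjoin_range : Algebra.adjoin k (Set.range toLin) = ⊤

open scoped IsMulCommutative in
/-- The left multiplications of an SLC algebra commute, so the subalgebra of `End A` which they
generate is commutative. -/
theorem IsSLC.exists_leftMulPresentation (k : Type*) {A : Type w} [CommRing k]
    [NonUnitalNonAssocRing A] [Module k A] [IsScalarTower k A A] [SMulCommClass k A A]
    (hA : IsSLC A) :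
    ∃ (M : Type w) (_ : CommRing M) (_ : Algebra k M) (_ : Module M A),
      IsScalarTower k M A ∧ Nonempty (LeftMulPresentation k A M) := by
  set S : Set (Module.End k A) := Set.range (LinearMap.mulLeft k : A → Module.End k A)
  have hc : ∀ a ∈ S, ∀ b ∈ S, a * b = b * a := by
    rintro _ ⟨a, rfl⟩ _ ⟨b, rfl⟩
    ext c
    exact hA.left_comm a b c
  have := Algebra.isMulCommutative_adjoin k hc
  refine ⟨Algebra.adjoin k S, inferInstance, inferInstance, inferInstance, inferInstance,
    ⟨{ toLin := (LinearMap.mul k A).codRestrict (Subalgebra.toSubmodule (Algebra.adjoin k S))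
        fun a => Algebra.subset_adjoin ⟨a, rfl⟩
       toLin_smul := fun a b => rfl
       faithful := fun S T h => Subtype.ext (LinearMap.ext h)
       adjoin_range := ?_ }⟩⟩
  rw [← Algebra.adjoin_adjoin_coe_preimage]
  congr 1
  ext ⟨T, hT⟩
  constructor
  · rintro ⟨a, ha⟩
    exact ⟨a, congrArg Subtype.val ha⟩
  · rintro ⟨a, ha⟩
    exact ⟨a, Subtype.ext ha⟩

namespace LeftMulPresentation

variable [NonUnitalNonAssocRing A] [Module k A] [CommRing M] [Algebra k M] [Module M A]
  (L : LeftMulPresentation k A M)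

theorem induction {motive : M → Prop} (T : M) (algebraMap : ∀ t : k, motive (algebraMap k M t))
    (toLin : ∀ a, motive (L.toLin a)) (add : ∀ S T, motive S → motive T → motive (S + T))
    (mul : ∀ S T, motive S → motive T → motive (S * T)) : motive T := by
  have hT : T ∈ Algebra.adjoin k (Set.range L.toLin) := L.adjoin_range ▸ Algebra.mem_top
  induction hT using Algebra.adjoin_induction with
  | mem T h => obtain ⟨a, rfl⟩ := h; exact toLin a
  | algebraMap t => exact algebraMap t
  | add S T _ _ hS hT => exact add S T hS hT
  | mul S T _ _ hS hT => exact mul S T hS hT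

/-- In `(P, ≻)` the operator `(T a)'` is `T' a + T a'`; this is the term `T' a`. -/
def derFun (a : A) (T : M) : M := L.toLin (T • a) - T * L.toLin a

theorem derFun_def (a : A) (T : M) : L.derFun a T = L.toLin (T • a) - T * L.toLin a := rfl

variable [IsScalarTower k M A]

theorem derFun_algebraMap (a : A) (t : k) : L.derFun a (algebraMap k M t) = 0 := by
  rw [derFun, algebraMap_smul, map_smul, Algebra.smul_def, sub_self]

omit [IsScalarTower k M A] in
theorem derFun_add (a : A) (S T : M) : L.derFun a (S + T) = L.derFun a S + L.derFun a T := by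
  simp only [derFun, add_smul, map_add]; ring

theorem derFun_smul (a : A) (t : k) (T : M) : L.derFun a (t • T) = t • L.derFun a T := by
  simp only [derFun, smul_assoc, map_smul, smul_mul_assoc, smul_sub]

omit [IsScalarTower k M A] in
theorem derFun_mul_left (a : A) (S T : M) :
    L.derFun a (S * T) = L.derFun (T • a) S + S * L.derFun a T := by
  simp only [derFun, mul_smul]; ring

variable (hA : IsSLC A)
include hA

omit [IsScalarTower k M A] in
theorem derFun_toLin_toLin_smul (a b c : A) :
    L.derFun (L.toLin c • a) (L.toLin b) = L.toLin c * L.derFun a (L.toLin b) := by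
  apply L.faithful
  intro e
  have h := hA.assoc_mul b c a e
  simp only [associator] at h
  simp only [derFun, sub_smul, mul_smul, L.toLin_smul, mul_sub]
  rw [hA.left_comm c (b * a) e, hA.left_comm c b (a * e), hA.left_comm c a e]
  exact sub_eq_zero.1 h

/-- The second SLC identity: `T' (S a) = S (T' a)`. -/
theorem derFun_smul_left (a : A) (S T : M) : L.derFun (S • a) T = S * L.derFun a T := by
  induction T using L.induction generalizing S with
  | algebraMap t => simp only [L.derFun_algebraMap, mul_zero]
  | add T T' h h' => rw [L.derFun_add, h, h', L.derFun_add]; ring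
  | mul T T' h h' =>
    rw [L.derFun_mul_left, L.derFun_mul_left, h', smul_smul, h, h]; ring
  | toLin b =>
    induction S using L.induction generalizing a with
    | algebraMap t =>
      rw [algebraMap_smul, derFun_def, derFun_def, smul_algebra_smul_comm, L.toLin.map_smul,
        L.toLin.map_smul, Algebra.smul_def, Algebra.smul_def]
      ring
    | toLin c => exact L.derFun_toLin_toLin_smul hA a b c
    | add S S' h h' =>
      rw [add_mul, ← h, ← h']
      simp only [derFun, add_smul, smul_add, map_add]; ring
    | mul S S' h h' => rw [mul_smul, h, h', mul_assoc]

theorem derFun_mul (a : A) (S T : M) :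
    L.derFun a (S * T) = S * L.derFun a T + T * L.derFun a S := by
  rw [L.derFun_mul_left, L.derFun_smul_left hA, add_comm]

/-- The derivation `T ↦ T' a` of the multiplication algebra. -/
def der (a : A) : Derivation k M M :=
  Derivation.mk' { toFun := L.derFun a, map_add' := L.derFun_add a, map_smul' := L.derFun_smul a }
    (L.derFun_mul hA a)

theorem der_apply (a : A) (T : M) : L.der hA a T = L.toLin (T • a) - T * L.toLin a := rfl

theorem toLin_smul_eq (a : A) (T : M) : L.toLin (T • a) = L.der hA a T + T * L.toLin a := by
  rw [L.der_apply]; ring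

theorem der_toLin_smul (a b c : A) : L.der hA b (L.toLin a) • c = associator a b c := by
  simp only [L.der_apply, sub_smul, mul_smul, L.toLin_smul, associator]

/-- The third SLC identity, as an equality of operators. -/
theorem toLin_der_toLin_smul_comm (a b c : A) :
    L.toLin (L.der hA b (L.toLin a) • c) = L.toLin (L.der hA c (L.toLin a) • b) := by
  apply L.faithful
  intro e
  rw [L.toLin_smul, L.toLin_smul, L.der_toLin_smul, L.der_toLin_smul]
  exact sub_eq_zero.1 (hA.assoc_symm a b c e)

/-- `(T' a)' b - a' (T' b) = T'' a b` is symmetric in `a` and `b`. -/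
theorem der_der_sub_comm (a b : A) (T : M) :
    L.der hA a (L.der hA b T) - L.toLin b * L.der hA a T =
      L.der hA b (L.der hA a T) - L.toLin a * L.der hA b T := by
  induction T using L.induction with
  | algebraMap t => simp only [Derivation.map_algebraMap, map_zero, mul_zero]
  | toLin x =>
    have h := L.toLin_der_toLin_smul_comm hA x a b
    rw [L.der_apply hA a (L.der hA b _), L.der_apply hA b (L.der hA a _), h]
    ring
  | add S T hS hT => simp only [map_add]; linear_combination hS + hT
  | mul S T hS hT =>
    simp only [Derivation.leibniz, smul_eq_mul, map_add]
    linear_combination T * hS + S * hT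

theorem der_toLin_mul_der_toLin_comm (a b x y : A) :
    L.der hA a (L.toLin x) * L.der hA b (L.toLin y) =
      L.der hA b (L.toLin x) * L.der hA a (L.toLin y) := by
  have key : ∀ a b : A, L.der hA a (L.toLin x) * L.der hA b (L.toLin y) =
      L.toLin (L.der hA b (L.toLin y) • (x * a)) -
        L.toLin x * L.toLin (L.der hA b (L.toLin y) • a) := by
    intro a b
    have h : L.der hA (L.der hA b (L.toLin y) • a) (L.toLin x) =
        L.der hA b (L.toLin y) * L.der hA a (L.toLin x) := L.derFun_smul_left hA _ _ _
    rw [mul_comm, ← h, L.der_apply hA _ (L.toLin x), smul_smul, mul_comm (L.toLin x), mul_smul,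
      L.toLin_smul]
  -- `L.toLin x` commutes with all operators and passes through the derivations
  have hx : ∀ a b : A, L.der hA (x * a) (L.toLin y) • b = L.der hA a (L.toLin y) • (x * b) := by
    intro a b
    have h : L.der hA (L.toLin x • a) (L.toLin y) = L.toLin x * L.der hA a (L.toLin y) :=
      L.derFun_smul_left hA _ _ _
    rw [← L.toLin_smul x a, ← L.toLin_smul x b, h, mul_comm, mul_smul]
  rw [key a b, key b a, L.toLin_der_toLin_smul_comm hA y b a,
    L.toLin_der_toLin_smul_comm hA y b (x * a), hx]

/-- `(S' a) (T' b) = (S' b) (T' a)`. -/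
theorem der_mul_der_comm (a b : A) (S T : M) :
    L.der hA a S * L.der hA b T = L.der hA b S * L.der hA a T := by
  induction S using L.induction with
  | algebraMap t => simp only [Derivation.map_algebraMap, zero_mul]
  | add S S' h h' => simp only [map_add]; linear_combination h + h'
  | mul S S' h h' =>
    simp only [Derivation.leibniz, smul_eq_mul]; linear_combination S' * h + S * h'
  | toLin x =>
    induction T using L.induction with
    | algebraMap t => simp only [Derivation.map_algebraMap, mul_zero]
    | add T T' h h' => simp only [map_add]; linear_combination h + h'
    | mul T T' h h' =>
      simp only [Derivation.leibniz, smul_eq_mul]; linear_combination T' * h + T * h'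
    | toLin y => exact L.der_toLin_mul_der_toLin_comm hA a b x y

end LeftMulPresentation

end Multiplication

/-! ### Blocks -/

section Blocks

variable {k X M : Type*} [CommRing k] [CommRing M] [Algebra k M] [DecidableEq X]

/-- Derivations `δ a` and elements `ℓ a` of `M` that behave like `T ↦ T' a` and `a'`, although
neither the letter `a` nor the derivation `d` need exist on `M`: the element
`(T' b)' a - b' T' a = T'' a b` is symmetric in `a` and `b`, and so is `(S' a) (T' b)`. -/
structure IsBlockSystem (ℓ : X → M) (δ : X → Derivation k M M) : Prop where
  comm : ∀ a b T, δ a (δ b T) - ℓ b * δ a T = δ b (δ a T) - ℓ a * δ b T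
  exchange : ∀ a b S T, δ a S * δ b T = δ b S * δ a T

/-- A function on multisets of `n` letters behaving as `s ↦ f · ∏ s` for a fixed `f` of
weight `n`. The values at multisets of other sizes are irrelevant. -/
structure IsBlockFun (ℓ : X → M) (δ : X → Derivation k M M) (n : ℕ) (f : Multiset X → M) :
    Prop where
  /-- Letters can be exchanged with every function `h` that behaves like `a ↦ h · a`. -/
  exchange : ∀ h : X → M, (∀ a b T, δ a T * h b = δ b T * h a) →
    ∀ a b r, r.card + 1 = n → f (a ::ₘ r) * h b = f (b ::ₘ r) * h a
  /-- `(f · b · ∏ r)' a - b' · f · a · ∏ r` is symmetric in `a` and `b`. -/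
  comm : ∀ a b r, r.card + 1 = n →
    δ a (f (b ::ₘ r)) - ℓ b * f (a ::ₘ r) = δ b (f (a ::ₘ r)) - ℓ a * f (b ::ₘ r)

variable {ℓ : X → M} {δ : X → Derivation k M M}

/-- The function `s ↦ f' · ∏ s`, computed as `(f · ∏ s)' a - ∑ z ∈ s, z' · f · a · ∏ (s - z)`
at the multiset `a ::ₘ s`. -/
def blockDer (ℓ : X → M) (δ : X → Derivation k M M) (f : Multiset X → M) (a : X)
    (s : Multiset X) : M :=
  δ a (f s) - (s.map fun z => ℓ z * f (a ::ₘ s.erase z)).sum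

theorem blockDer_cons (f : Multiset X → M) (a b : X) (r : Multiset X) :
    blockDer ℓ δ f a (b ::ₘ r) = δ a (f (b ::ₘ r)) - ℓ b * f (a ::ₘ r) -
      (r.map fun z => ℓ z * f (a ::ₘ b ::ₘ r.erase z)).sum := by
  rw [blockDer, Multiset.map_cons, Multiset.sum_cons, Multiset.erase_cons_head]
  have : (r.map fun z => ℓ z * f (a ::ₘ (b ::ₘ r).erase z)) =
      r.map fun z => ℓ z * f (a ::ₘ b ::ₘ r.erase z) :=
    Multiset.map_congr rfl fun z hz => by rw [Multiset.erase_cons_tail_of_mem hz]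
  rw [this, sub_sub]

/-- `blockDer` depends only on the multiset `a ::ₘ s`, not on the choice of `a`. -/
theorem IsBlockFun.blockDer_swap {n : ℕ} {f : Multiset X → M} (hf : IsBlockFun ℓ δ n f)
    (a b : X) (r : Multiset X) (hr : r.card + 1 = n) :
    blockDer ℓ δ f a (b ::ₘ r) = blockDer ℓ δ f b (a ::ₘ r) := by
  rw [blockDer_cons, blockDer_cons, hf.comm a b r hr]
  simp only [Multiset.cons_swap a b]

theorem IsBlockFun.blockDer_mul {n : ℕ} {f : Multiset X → M} (hf : IsBlockFun ℓ δ n f)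
    {h : X → M} (hh : ∀ a b T, δ a T * h b = δ b T * h a) (a b : X) (r : Multiset X)
    (hr : r.card = n) : blockDer ℓ δ f a r * h b = blockDer ℓ δ f b r * h a := by
  rw [blockDer, blockDer, sub_mul, sub_mul, hh, ← Multiset.sum_map_mul_right,
    ← Multiset.sum_map_mul_right]
  congr 2
  refine Multiset.map_congr rfl fun z hz => ?_
  rw [mul_assoc, mul_assoc, hf.exchange h hh]
  rw [Multiset.card_erase_add_one hz, hr]

theorem IsBlockFun.blockDer_comm (hδ : IsBlockSystem ℓ δ) {n : ℕ} {f : Multiset X → M}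
    (hf : IsBlockFun ℓ δ n f) (a b : X) (r : Multiset X) (hr : r.card = n) :
    δ a (blockDer ℓ δ f b r) - ℓ b * blockDer ℓ δ f a r =
      δ b (blockDer ℓ δ f a r) - ℓ a * blockDer ℓ δ f b r := by
  have expand : ∀ a b, δ a (blockDer ℓ δ f b r) - ℓ b * blockDer ℓ δ f a r =
      (δ a (δ b (f r)) - ℓ b * δ a (f r)) - (r.map fun z =>
        (δ a (ℓ z) * f (b ::ₘ r.erase z) +
          ℓ z * (δ a (f (b ::ₘ r.erase z)) - ℓ b * f (a ::ₘ r.erase z)))).sum := by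
    intro a b
    rw [blockDer, blockDer, map_sub, map_multiset_sum, Multiset.map_map, mul_sub,
      ← Multiset.sum_map_mul_left, sub_sub_sub_comm, ← Multiset.sum_map_sub]
    congr 2
    refine Multiset.map_congr rfl fun z _ => ?_
    simp only [Function.comp_apply, Derivation.leibniz, smul_eq_mul]
    ring
  rw [expand a b, expand b a, hδ.comm]
  congr 2
  refine Multiset.map_congr rfl fun z hz => ?_
  have hz' : (r.erase z).card + 1 = n := by rw [Multiset.card_erase_add_one hz, hr]
  have h := hf.exchange (fun a => δ a (ℓ z)) (fun a b T => hδ.exchange a b T (ℓ z)) b a _ hz'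
  rw [hf.comm a b _ hz', mul_comm, h, mul_comm]

/-- The derivative of a block function of weight `n` is a block function of weight `n + 1`. -/
theorem IsBlockFun.exists_der (hδ : IsBlockSystem ℓ δ) {n : ℕ} {f : Multiset X → M}
    (hf : IsBlockFun ℓ δ n f) : ∃ g : Multiset X → M, IsBlockFun ℓ δ (n + 1) g ∧
      ∀ a s, s.card = n → g (a ::ₘ s) = blockDer ℓ δ f a s := by
  classical
  let g : Multiset X → M := fun u =>
    if h : ∃ a, a ∈ u then blockDer ℓ δ f h.choose (u.erase h.choose) else 0
  have hg : ∀ a s, s.card = n → g (a ::ₘ s) = blockDer ℓ δ f a s := by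
    intro a s hs
    have h : ∃ b, b ∈ a ::ₘ s := ⟨a, Multiset.mem_cons_self a s⟩
    change dite _ _ _ = _
    rw [dif_pos h]
    generalize hb : h.choose = b
    have hmem : b ∈ a ::ₘ s := hb ▸ h.choose_spec
    by_cases hab : b = a
    · rw [hab, Multiset.erase_cons_head]
    · have hbs : b ∈ s := (Multiset.mem_cons.1 hmem).resolve_left hab
      obtain ⟨r, rfl⟩ := Multiset.exists_cons_of_mem hbs
      rw [Multiset.cons_swap, Multiset.erase_cons_head]
      exact hf.blockDer_swap b a r (by rw [← hs, Multiset.card_cons])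
  refine ⟨g, ⟨fun h hh a b r hr => ?_, fun a b r hr => ?_⟩, hg⟩
  · rw [hg a r (by omega), hg b r (by omega)]
    exact hf.blockDer_mul hh a b r (by omega)
  · rw [hg a r (by omega), hg b r (by omega)]
    exact hf.blockDer_comm hδ a b r (by omega)

/-- A family of blocks `V x s`, which stand for `x⁽ⁿ⁺¹⁾ · ∏ s` with `n` the cardinality of `s`. -/
structure IsBlockFamily (ℓ : X → M) (δ : X → Derivation k M M) (V : X → Multiset X → M) :
    Prop where
  zero : ∀ x, V x 0 = ℓ x
  exchange : ∀ x y a b s t, V x (a ::ₘ s) * V y (b ::ₘ t) = V x (b ::ₘ s) * V y (a ::ₘ t)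
  der : ∀ x a s, δ a (V x s) =
    V x (a ::ₘ s) + (s.map fun z => ℓ z * V x (a ::ₘ s.erase z)).sum

theorem IsBlockSystem.exists_blockFamily (hδ : IsBlockSystem ℓ δ) :
    ∃ V, IsBlockFamily ℓ δ V := by
  choose! D hD hD' using fun n f (hf : IsBlockFun ℓ δ n f) => hf.exists_der hδ
  -- `W x n` is the block function of `x⁽ⁿ⁺¹⁾`
  let W : X → ℕ → Multiset X → M := fun x n => n.rec (fun _ => ℓ x) D
  have hW : ∀ x n, IsBlockFun ℓ δ n (W x n) := by
    intro x n
    induction n with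
    | zero => exact ⟨fun _ _ _ _ _ h => absurd h (Nat.succ_ne_zero _),
        fun _ _ _ h => absurd h (Nat.succ_ne_zero _)⟩
    | succ n ih => exact hD n _ ih
  have hW' : ∀ x a s, W x (s.card + 1) (a ::ₘ s) = blockDer ℓ δ (W x s.card) a s :=
    fun x a s => hD' s.card _ (hW x s.card) a s rfl
  refine ⟨fun x s => W x s.card s, fun x => rfl, fun x y a b s t => ?_, fun x a s => ?_⟩
  · simp only [Multiset.card_cons]
    refine (hW x _).exchange (fun b => W y (t.card + 1) (b ::ₘ t)) (fun a b T => ?_) a b s rfl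
    have := (hW y (t.card + 1)).exchange (fun a => δ a T)
      (fun a b S => hδ.exchange a b S T) b a t rfl
    rw [mul_comm (δ a T), this, mul_comm]
  · have : (s.map fun z => ℓ z * W x (a ::ₘ s.erase z).card (a ::ₘ s.erase z)) =
        s.map fun z => ℓ z * W x s.card (a ::ₘ s.erase z) :=
      Multiset.map_congr rfl fun z hz => by
        rw [Multiset.card_cons, Multiset.card_erase_add_one hz]
    rw [this, Multiset.card_cons, hW', blockDer, sub_add_cancel]

/-! ### Products of blocks depend only on their monomials -/

/-- The kind `(x, n)` of a block `x⁽ⁿ⁺¹⁾ · ∏ s`, where `n` is the cardinality of `s`. -/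
def blockKind (b : X × Multiset X) : X × ℕ := (b.1, b.2.card)

namespace IsBlockFamily

variable {V : X → Multiset X → M} (hV : IsBlockFamily ℓ δ V)
include hV

/-- Exchanging letters with the other factors, the multiset `s` of letters of a block can be
replaced by any multiset `s'` of the same size that is contained in the product. -/
theorem exists_rearrangement (x : X) (s' : Multiset X) :
    ∀ (r s u : Multiset X) (C : Multiset (X × Multiset X)), s.card = s'.card →
      s + (C.map Prod.snd).sum = s' + u →
      ∃ C' : Multiset (X × Multiset X), C'.map blockKind = C.map blockKind ∧
        (C'.map Prod.snd).sum = u ∧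
        V x (r + s) * (C.map fun b => V b.1 b.2).prod =
          V x (r + s') * (C'.map fun b => V b.1 b.2).prod := by
  induction s' using Multiset.induction_on with
  | empty =>
    intro r s u C hs h
    obtain rfl : s = 0 := Multiset.card_eq_zero.1 hs
    exact ⟨C, rfl, by simpa using h, rfl⟩
  | cons b s' ih =>
    intro r s u C hs h
    by_cases hb : b ∈ s
    · obtain ⟨s, rfl⟩ := Multiset.exists_cons_of_mem hb
      rw [Multiset.cons_add, Multiset.cons_add, Multiset.cons_inj_right] at h
      obtain ⟨C', h₁, h₂, h₃⟩ := ih (b ::ₘ r) s u C (by simpa using hs) h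
      refine ⟨C', h₁, h₂, ?_⟩
      rwa [Multiset.add_cons, Multiset.add_cons, ← Multiset.cons_add, ← Multiset.cons_add]
    -- exchange a letter `a` of the block with the letter `b` of another block
    · have hbC : b ∈ (C.map Prod.snd).sum := by
        have : b ∈ s + (C.map Prod.snd).sum := by
          rw [h]; exact Multiset.mem_add.2 (.inl (Multiset.mem_cons_self b s'))
        exact (Multiset.mem_add.1 this).resolve_left hb
      obtain ⟨a, s, rfl⟩ : ∃ a s₁, s = a ::ₘ s₁ := by
        have : 0 < s.card := by rw [hs, Multiset.card_cons]; omega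
        obtain ⟨a, ha⟩ := Multiset.card_pos_iff_exists_mem.1 this
        exact ⟨a, Multiset.exists_cons_of_mem ha⟩
      obtain ⟨_, hc, hbc⟩ := (Multiset.mem_join (S := C.map Prod.snd)).1 hbC
      obtain ⟨⟨y, t⟩, hyC, rfl⟩ := Multiset.mem_map.1 hc
      obtain ⟨t, rfl⟩ := Multiset.exists_cons_of_mem hbc
      obtain ⟨C, rfl⟩ := Multiset.exists_cons_of_mem hyC
      have h' : s + (((y, a ::ₘ t) ::ₘ C).map Prod.snd).sum = s' + u := by
        have e : b ::ₘ (s + (((y, a ::ₘ t) ::ₘ C).map Prod.snd).sum) =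
            a ::ₘ s + (((y, b ::ₘ t) ::ₘ C).map Prod.snd).sum := by
          simp only [Multiset.map_cons, Multiset.sum_cons]
          simp only [← Multiset.singleton_add]
          abel
        rw [h, Multiset.cons_add, Multiset.cons_inj_right] at e
        exact e
      obtain ⟨C', h₁, h₂, h₃⟩ := ih (b ::ₘ r) s u ((y, a ::ₘ t) ::ₘ C) (by simpa using hs) h'
      refine ⟨C', ?_, h₂, ?_⟩
      · rw [h₁]; simp only [Multiset.map_cons, blockKind, Multiset.card_cons]
      · rw [Multiset.add_cons, Multiset.add_cons, ← Multiset.cons_add b r s', ← h₃,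
          Multiset.map_cons, Multiset.map_cons, Multiset.prod_cons, Multiset.prod_cons,
          ← mul_assoc, ← mul_assoc, hV.exchange, Multiset.cons_add]

/-- A product of blocks is determined by the kinds of the blocks and by all their letters together,
that is, by its monomial. -/
theorem prod_eq_prod (B : Multiset (X × Multiset X)) :
    ∀ B' : Multiset (X × Multiset X), B.map blockKind = B'.map blockKind →
      (B.map Prod.snd).sum = (B'.map Prod.snd).sum →
      (B.map fun b => V b.1 b.2).prod = (B'.map fun b => V b.1 b.2).prod := by
  induction B using Multiset.induction_on with
  | empty =>
    intro B' h _
    rw [Multiset.map_eq_zero.1 h.symm]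
  | cons b B ih =>
    obtain ⟨x, s⟩ := b
    intro B' h h'
    have hmem : blockKind (x, s) ∈ B'.map blockKind := by
      rw [← h]; exact Multiset.mem_map_of_mem _ (Multiset.mem_cons_self _ _)
    obtain ⟨⟨y, t⟩, hy, hyx⟩ := Multiset.mem_map.1 hmem
    obtain ⟨C, rfl⟩ := Multiset.exists_cons_of_mem hy
    obtain ⟨rfl, hts⟩ : y = x ∧ t.card = s.card := Prod.mk.inj hyx
    rw [Multiset.map_cons, Multiset.map_cons, hyx, Multiset.cons_inj_right] at h
    rw [Multiset.map_cons, Multiset.map_cons, Multiset.sum_cons, Multiset.sum_cons] at h'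
    obtain ⟨C', h₁, h₂, h₃⟩ := hV.exists_rearrangement y s 0 t _ C hts h'.symm
    rw [zero_add, zero_add] at h₃
    rw [Multiset.map_cons, Multiset.map_cons, Multiset.prod_cons, Multiset.prod_cons, h₃,
      ih C' (h.trans h₁.symm) h₂.symm]

end IsBlockFamily

end Blocks

/-! ### Operators represented by polynomials of weight zero -/

section BlockGraph

variable {k X M : Type*} [CommRing k] [CommRing M] [Algebra k M] [DecidableEq X]

/-- The exponent of the monomial of a product of blocks of kinds `K` and letters `U`. -/
def blockExponent (K : Multiset (X × ℕ)) (U : Multiset X) : Multiset (X × ℕ) :=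
  K.map (fun p => (p.1, p.2 + 1)) + U.map fun y => (y, 0)

omit [DecidableEq X] in
/-- Letters with and without derivatives do not mix, so the exponent determines `K` and `U`. -/
theorem blockExponent_inj {K K' : Multiset (X × ℕ)} {U U' : Multiset X}
    (h : blockExponent K U = blockExponent K' U') : K = K' ∧ U = U' := by
  have h₀ : ∀ (K : Multiset (X × ℕ)) (U : Multiset X),
      (blockExponent K U).filter (fun p => p.2 = 0) = U.map fun y => (y, 0) := by
    intro K U
    rw [blockExponent, Multiset.filter_add, Multiset.filter_eq_nil.2, zero_add,
      Multiset.filter_eq_self.2]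
    · intro p hp
      obtain ⟨y, _, rfl⟩ := Multiset.mem_map.1 hp
      rfl
    · intro p hp
      obtain ⟨y, _, rfl⟩ := Multiset.mem_map.1 hp
      exact Nat.succ_ne_zero _
  have hU : U = U' := by
    refine Multiset.map_injective (f := fun y : X => (y, 0)) (fun a b hab => congrArg Prod.fst hab)
      ?_
    rw [← h₀ K U, h, h₀]
  subst hU
  refine ⟨?_, rfl⟩
  refine Multiset.map_injective (f := fun p : X × ℕ => (p.1, p.2 + 1)) ?_
    (add_right_cancel h)
  rintro ⟨a, m⟩ ⟨b, n⟩ hab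
  simpa using hab

theorem prod_map_X_eq_monomial {σ : Type*} [DecidableEq σ] (m : Multiset σ) :
    (m.map (MvPolynomial.X : σ → MvPolynomial σ k)).prod =
      MvPolynomial.monomial (Multiset.toFinsupp m) 1 := by
  induction m using Multiset.induction_on with
  | empty => simp
  | cons a m ih =>
    rw [Multiset.map_cons, Multiset.prod_cons, ih, MvPolynomial.X, MvPolynomial.monomial_mul,
      one_mul, ← Multiset.toFinsupp_singleton, ← map_add, Multiset.singleton_add]

variable (k) in
/-- The monomial `x⁽ⁿ⁺¹⁾ · ∏ s` with `n` the cardinality of `s`. -/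
noncomputable def blockMonomial (b : X × Multiset X) : MvPolynomial (X × ℕ) k :=
  MvPolynomial.X (b.1, b.2.card + 1) * (b.2.map fun y => MvPolynomial.X (y, 0)).prod

theorem prod_blockMonomial (B : Multiset (X × Multiset X)) :
    (B.map (blockMonomial k)).prod = MvPolynomial.monomial
      (Multiset.toFinsupp (blockExponent (B.map blockKind) (B.map Prod.snd).sum)) 1 := by
  rw [← prod_map_X_eq_monomial]
  induction B using Multiset.induction_on with
  | empty => simp [blockExponent]
  | cons b B ih =>
    rw [Multiset.map_cons, Multiset.prod_cons, ih]
    simp only [blockExponent, blockMonomial, blockKind, Multiset.map_cons, Multiset.sum_cons,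
      Multiset.map_add, Multiset.prod_add, Multiset.prod_cons, Multiset.map_map,
      Function.comp_def, Multiset.cons_add]
    ring

theorem polyDer_prod_X (s : Multiset X) :
    FreeDerPerm.polyDer k X (s.map fun y => MvPolynomial.X (y, 0)).prod =
      (s.map fun z => MvPolynomial.X (z, 1) *
        ((s.erase z).map fun y => MvPolynomial.X (y, 0)).prod).sum := by
  induction s using Multiset.induction_on with
  | empty => simp
  | cons a s ih =>
    rw [Multiset.map_cons, Multiset.prod_cons, Derivation.leibniz, ih, FreeDerPerm.polyDer,
      MvPolynomial.mkDerivation_X, Multiset.map_cons, Multiset.sum_cons, Multiset.erase_cons_head,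
      add_comm, smul_eq_mul, smul_eq_mul, mul_comm, ← Multiset.sum_map_mul_left]
    congr 2
    refine Multiset.map_congr rfl fun z hz => ?_
    rw [Multiset.erase_cons_tail_of_mem hz, Multiset.map_cons, Multiset.prod_cons]
    ring

/-- The counterpart in the polynomial ring of `IsBlockFamily.der`. -/
theorem X_mul_polyDer_blockMonomial (x a : X) (s : Multiset X) :
    MvPolynomial.X (a, 0) * FreeDerPerm.polyDer k X (blockMonomial k (x, s)) =
      blockMonomial k (x, a ::ₘ s) + (s.map fun z =>
        blockMonomial k (z, 0) * blockMonomial k (x, a ::ₘ s.erase z)).sum := by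
  have h : (s.map fun z => blockMonomial k (z, 0) * blockMonomial k (x, a ::ₘ s.erase z)) =
      s.map fun z => (MvPolynomial.X (a, 0) * MvPolynomial.X (x, s.card + 1)) *
        (MvPolynomial.X (z, 1) * ((s.erase z).map fun y => MvPolynomial.X (y, 0)).prod) := by
    refine Multiset.map_congr rfl fun z hz => ?_
    simp only [blockMonomial, Multiset.card_cons, Multiset.card_erase_add_one hz,
      Multiset.map_cons, Multiset.prod_cons, Multiset.map_zero, Multiset.prod_zero,
      Multiset.card_zero, zero_add, mul_one]
    ring
  rw [h, Multiset.sum_map_mul_left, ← polyDer_prod_X]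
  simp only [blockMonomial, Derivation.leibniz, smul_eq_mul, Multiset.card_cons, Multiset.map_cons,
    Multiset.prod_cons]
  rw [FreeDerPerm.polyDer, MvPolynomial.mkDerivation_X]
  ring

namespace IsBlockFamily

variable {ℓ : X → M} {δ : X → Derivation k M M} {V : X → Multiset X → M}

/-- Since distinct monomials are linearly independent, sending the monomial of a product of blocks
to the value of that product extends to a linear map. -/
theorem exists_linearMap (hV : IsBlockFamily ℓ δ V) :
    ∃ Φ : MvPolynomial (X × ℕ) k →ₗ[k] M, ∀ B : Multiset (X × Multiset X),
      Φ (B.map (blockMonomial k)).prod = (B.map fun b => V b.1 b.2).prod := by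
  classical
  let e : Multiset (X × Multiset X) → (X × ℕ →₀ ℕ) := fun B =>
    Multiset.toFinsupp (blockExponent (B.map blockKind) (B.map Prod.snd).sum)
  refine ⟨(MvPolynomial.basisMonomials (X × ℕ) k).constr k fun m =>
    if h : ∃ B, e B = m then (h.choose.map fun b => V b.1 b.2).prod else 0, fun B => ?_⟩
  have h : ∃ B', e B' = e B := ⟨B, rfl⟩
  have hB := blockExponent_inj (Multiset.toFinsupp.injective h.choose_spec)
  rw [prod_blockMonomial, ← congrFun (MvPolynomial.coe_basisMonomials (X × ℕ) k),
    Module.Basis.constr_basis]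
  change dite (∃ B', e B' = e B) _ _ = _
  rw [dif_pos h]
  exact hV.prod_eq_prod _ _ hB.1 hB.2

variable (k V) in
/-- The relation "`T` represents the polynomial `p`", generated as a subalgebra by the blocks. -/
noncomputable def graph : Subalgebra k (MvPolynomial (X × ℕ) k × M) :=
  Algebra.adjoin k (Set.range fun b : X × Multiset X => (blockMonomial k b, V b.1 b.2))

omit [DecidableEq X] in
theorem mem_graph (x : X) (s : Multiset X) : (blockMonomial k (x, s), V x s) ∈ graph k V :=
  Algebra.subset_adjoin ⟨(x, s), rfl⟩

omit [DecidableEq X] in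
/-- Every polynomial represents at most one element of `M`. -/
theorem eq_of_mem_graph {Φ : MvPolynomial (X × ℕ) k →ₗ[k] M}
    (hΦ : ∀ B : Multiset (X × Multiset X),
      Φ (B.map (blockMonomial k)).prod = (B.map fun b => V b.1 b.2).prod)
    {q : MvPolynomial (X × ℕ) k × M} (hq : q ∈ graph k V) : Φ q.1 = q.2 := by
  rw [graph, ← Subalgebra.mem_toSubmodule, Algebra.adjoin_eq_span] at hq
  induction hq using Submodule.span_induction with
  | zero => exact map_zero Φ
  | add q r _ _ hq hr => rw [Prod.fst_add, Prod.snd_add, map_add, hq, hr]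
  | smul t q _ hq => rw [Prod.smul_fst, Prod.smul_snd, map_smul, hq]
  | mem q hq =>
    obtain ⟨B, rfl⟩ : ∃ B : Multiset (X × Multiset X),
        (B.map fun b => (blockMonomial k b, V b.1 b.2)).prod = q := by
      induction hq using Submonoid.closure_induction with
      | mem q h => obtain ⟨b, rfl⟩ := h; exact ⟨{b}, by simp⟩
      | one => exact ⟨0, by simp⟩
      | mul q r _ _ hq hr =>
        obtain ⟨B, rfl⟩ := hq
        obtain ⟨C, rfl⟩ := hr
        exact ⟨B + C, by rw [Multiset.map_add, Multiset.prod_add]⟩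
    rw [Multiset.fst_prod, Multiset.snd_prod, Multiset.map_map, Multiset.map_map]
    exact hΦ B

/-- The representation is compatible with the derivations `p ↦ p' a` and `δ a`. -/
theorem der_mem_graph (hV : IsBlockFamily ℓ δ V) (a : X) {q : MvPolynomial (X × ℕ) k × M}
    (hq : q ∈ graph k V) :
    (MvPolynomial.X (a, 0) * FreeDerPerm.polyDer k X q.1, δ a q.2) ∈ graph k V := by
  rw [graph] at hq
  induction hq using Algebra.adjoin_induction with
  | mem q h =>
    obtain ⟨⟨x, s⟩, rfl⟩ := h
    have : (s.map fun z => (blockMonomial k (z, 0), V z 0) *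
        (blockMonomial k (x, a ::ₘ s.erase z), V x (a ::ₘ s.erase z))).sum ∈ graph k V :=
      Subalgebra.multiset_sum_mem _ fun q hq => by
        obtain ⟨z, _, rfl⟩ := Multiset.mem_map.1 hq
        exact mul_mem (mem_graph z 0) (mem_graph x _)
    convert add_mem (mem_graph (k := k) (V := V) x (a ::ₘ s)) this using 1
    refine Prod.ext ?_ ?_
    · rw [Prod.fst_add, Multiset.fst_sum, Multiset.map_map]
      exact X_mul_polyDer_blockMonomial x a s
    · rw [Prod.snd_add, Multiset.snd_sum, Multiset.map_map]
      simp only [hV.der, ← hV.zero]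
      rfl
  | algebraMap t =>
    have h₁ : FreeDerPerm.polyDer k X (algebraMap k (MvPolynomial (X × ℕ) k × M) t).1 = 0 :=
      Derivation.map_algebraMap _ t
    have h₂ : δ a (algebraMap k (MvPolynomial (X × ℕ) k × M) t).2 = 0 :=
      Derivation.map_algebraMap _ t
    rw [h₁, h₂, mul_zero]
    exact zero_mem _
  | add q r hq hr ihq ihr =>
    have := add_mem ihq ihr
    rw [Prod.mk_add_mk, ← mul_add, ← map_add, ← map_add] at this
    exact this
  | mul q r hq hr ihq ihr =>
    have hq' : q ∈ graph k V := hq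
    have hr' : r ∈ graph k V := hr
    have := add_mem (mul_mem hq' ihr) (mul_mem hr' ihq)
    convert this using 1
    refine Prod.ext ?_ ?_
    · simp only [Prod.fst_mul, Prod.fst_add, Derivation.leibniz, smul_eq_mul]; ring
    · simp only [Prod.snd_mul, Prod.snd_add, Derivation.leibniz, smul_eq_mul]

end IsBlockFamily

end BlockGraph

/-! ### Injectivity of the map from the free SLC algebra -/

namespace SuccAlgebra

variable {k P : Type*} [CommRing k] [NonUnitalRing P] [Module k P] (d : PermDerivation k P)

/-- In `(P, ≻)` the associator of `a`, `b`, `c` is `a'' b c`. -/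
theorem associator_eq (a b c : P) :
    associator (of d a) (of d b) (of d c) = of d (d (d a) * b * c) := by
  change d (d a * b) * c - d a * (d b * c) = d (d a) * b * c
  rw [d.leibniz, add_mul, mul_assoc (d a), add_sub_cancel_right]

theorem isSLC [IsPermAlgebra P] : IsSLC (SuccAlgebra d) where
  left_comm := fun (a b c : P) => by
    change d a * (d b * c) = d b * (d a * c)
    rw [← mul_assoc, IsPermAlgebra.left_comm, mul_assoc]
  assoc_mul := fun (a b c e : P) => by
    have h₁ := associator_eq d a (d b * c) e
    have h₂ := associator_eq d a c (d b * e)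
    refine sub_eq_zero.2 (h₁.trans (Eq.trans ?_ h₂.symm))
    change d (d a) * (d b * c) * e = d (d a) * c * (d b * e)
    rw [mul_assoc, IsPermAlgebra.left_comm (d b), mul_assoc, mul_assoc]
  assoc_symm := fun (a b c e : P) => by
    have h₁ := associator_eq d a b c
    have h₂ := associator_eq d a c b
    refine sub_eq_zero.2 ((congrArg (· * of d e) h₁).trans (Eq.trans ?_ (congrArg (· * of d e) h₂).symm))
    have swap : ∀ y z w : P, y * (z * w) = z * (y * w) := fun y z w => by
      rw [← mul_assoc, IsPermAlgebra.left_comm, mul_assoc]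
    have key : d (d (d a) * b * c) * e = d (d (d a) * c * b) * e := by
      simp only [d.leibniz, add_mul, mul_assoc, swap c, swap (d c)]
      abel_nf
    exact key

end SuccAlgebra

namespace FreeSLC

variable {k : Type u} {X : Type v} [CommRing k]

open FreeDerPerm in
/-- The free SLC algebra maps injectively to `(Der Perm⟨X⟩, ≻)`: the linear map
`p x ↦ Φ(p) • x` is a left inverse, where `Φ` sends a polynomial of weight zero to the operator
it represents. -/
theorem injective_of_map_of (φ : FreeSLC k X →ₙₐ[k] SuccAlgebra (FreeDerPerm.der k X))
    (hφ : ∀ x, φ (of k x) = SuccAlgebra.of _ (FreeDerPerm.of k x)) : Function.Injective φ := by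
  classical
  have hA : IsSLC (FreeSLC k X) := isSLC k
  obtain ⟨M, _, _, _, _, ⟨L⟩⟩ := hA.exists_leftMulPresentation k
  have hδ : IsBlockSystem (fun x : X => L.toLin (of k x)) (fun x => L.der hA (of k x)) :=
    ⟨fun a b T => L.der_der_sub_comm hA _ _ T, fun a b S T => L.der_mul_der_comm hA _ _ S T⟩
  obtain ⟨V, hV⟩ := hδ.exists_blockFamily
  obtain ⟨Φ, hΦ⟩ := hV.exists_linearMap
  let Ψ : FreeDerPerm k X →ₗ[k] FreeSLC k X := Finsupp.lsum k fun y =>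
    (LinearMap.toSpanSingleton M _ (of k y.1)).restrictScalars k ∘ₗ Φ
  have hΨ : ∀ x p, Ψ (term k (x, 0) p) = Φ p • of k x := by
    intro x p
    change Finsupp.lsum k _ (Finsupp.single (x, 0) p) = _
    rw [Finsupp.lsum_single]
    rfl
  -- the graph of the inverse correspondence, spanned by the pairs `(p x, T x)`
  let pair : X → MvPolynomial (X × ℕ) k × M →
      SuccAlgebra (FreeDerPerm.der k X) × FreeSLC k X :=
    fun x q => (SuccAlgebra.of _ (term k (x, 0) q.1), q.2 • of k x)
  let gens : Set (SuccAlgebra (FreeDerPerm.der k X) × FreeSLC k X) :=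
    {r | ∃ x, ∃ q ∈ IsBlockFamily.graph k V, pair x q = r}
  -- `(p x) ≻ (q y) = (p' x + p x') q y`, and the operators satisfy the same rule
  have hmul : ∀ r ∈ gens, ∀ r' ∈ gens, r * r' ∈ gens := by
    rintro _ ⟨x, q, hq, rfl⟩ _ ⟨y, q', hq', rfl⟩
    have hx : (MvPolynomial.X (x, 1), L.toLin (of k x)) ∈ IsBlockFamily.graph k V := by
      have := IsBlockFamily.mem_graph (k := k) (V := V) x 0
      simpa [blockMonomial, hV.zero] using this
    refine ⟨y, _, mul_mem (add_mem (hV.der_mem_graph x hq) (mul_mem hq hx)) hq', ?_⟩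
    refine Prod.ext ?_ ?_
    · change term k (y, 0) _ = derLin k X (term k (x, 0) q.1) * term k (y, 0) q'.1
      rw [derLin_term, FreeDerPerm.mul_def, map_add, forget_term, forget_term, smul_term]
      congr 1
      simp only [Prod.fst_mul, Prod.fst_add]
      ring
    · change _ = (q.2 • of k x) * (q'.2 • of k y)
      rw [← L.toLin_smul, L.toLin_smul_eq hA, smul_smul]
      rfl
  let S : NonUnitalSubalgebra k (SuccAlgebra (FreeDerPerm.der k X) × FreeSLC k X) :=
    { Submodule.span k gens with
      mul_mem' := by
        intro r r' hr hr'
        change r * r' ∈ Submodule.span k gens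
        induction hr, hr' using Submodule.span_induction₂ with
        | mem_mem r r' hr hr' => exact Submodule.subset_span (hmul r hr r' hr')
        | zero_left r _ => rw [zero_mul]; exact zero_mem _
        | zero_right r _ => rw [mul_zero]; exact zero_mem _
        | add_left r s t _ _ _ h h' => rw [add_mul]; exact add_mem h h'
        | add_right r s t _ _ _ h h' => rw [mul_add]; exact add_mem h h'
        | smul_left c r s _ _ h => rw [smul_mul_assoc]; exact Submodule.smul_mem _ c h
        | smul_right c r s _ _ h => rw [mul_smul_comm]; exact Submodule.smul_mem _ c h }
  have hS : ∀ r ∈ S, Ψ ((SuccAlgebra.of _).symm r.1) = r.2 := by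
    intro r hr
    change r ∈ Submodule.span k gens at hr
    induction hr using Submodule.span_induction with
    | mem r h =>
      obtain ⟨x, q, hq, rfl⟩ := h
      exact (hΨ x q.1).trans (by rw [IsBlockFamily.eq_of_mem_graph hΦ hq])
    | zero => simp only [Prod.fst_zero, Prod.snd_zero, map_zero]
    | add r s _ _ h h' => simp only [Prod.fst_add, Prod.snd_add, map_add, h, h']
    | smul c r _ h => simp only [Prod.smul_fst, Prod.smul_snd, map_smul, h]
  -- a homomorphism from the free nonassociative algebra into `S` with the expected components
  let Λ : FreeNonUnitalNonAssocAlgebra k X →ₙₐ[k] S :=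
    FreeNonUnitalNonAssocAlgebra.lift k fun x =>
      ⟨pair x 1, Submodule.subset_span ⟨x, 1, one_mem _, rfl⟩⟩
  have hΛ₁ : (NonUnitalAlgHom.fst k _ _).comp ((NonUnitalSubalgebraClass.subtype S).comp Λ) =
      φ.comp (mk k X) := by
    apply FreeNonUnitalNonAssocAlgebra.hom_ext
    intro x
    change (Λ (FreeNonUnitalNonAssocAlgebra.of k x)).1.1 = φ (of k x)
    rw [hφ, FreeNonUnitalNonAssocAlgebra.lift_of_apply]
    rfl
  have hΛ₂ : (NonUnitalAlgHom.snd k _ _).comp ((NonUnitalSubalgebraClass.subtype S).comp Λ) =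
      mk k X := by
    apply FreeNonUnitalNonAssocAlgebra.hom_ext
    intro x
    change (Λ (FreeNonUnitalNonAssocAlgebra.of k x)).1.2 = of k x
    rw [FreeNonUnitalNonAssocAlgebra.lift_of_apply]
    exact one_smul M _
  have hΨφ : ∀ a, Ψ ((SuccAlgebra.of _).symm (φ a)) = a := by
    intro a
    obtain ⟨b, rfl⟩ := Quot.mk_surjective a
    have h₁ : (Λ b).1.1 = φ (mk k X b) := DFunLike.congr_fun hΛ₁ b
    have h₂ : (Λ b).1.2 = mk k X b := DFunLike.congr_fun hΛ₂ b
    have h := hS _ (Λ b).2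
    rw [h₁, h₂] at h
    exact h
  exact Function.LeftInverse.injective hΨφ

end FreeSLC

/-! ### The variety generated by the `Der Perm_≻` algebras -/

section Variety

variable (k : Type u) [CommRing k]

/-- A polynomial that is an identity of all `(P, ≻)` vanishes at the generators of
`(Der Perm⟨X⟩, ≻)`, hence at those of the free SLC algebra, hence in every SLC algebra. -/
theorem inSuccVariety_of_isSLC {A : Type w} [NonUnitalNonAssocRing A] [Module k A]
    [IsScalarTower k A A] [SMulCommClass k A A] (hA : IsSLC A) : InSuccVariety.{u, v, w} k A := by
  intro f hf s
  -- variables are lifted to the universe over which the perm algebras range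
  let Y := ULift.{v} ℕ
  obtain ⟨φ, hφ, -⟩ := FreeSLC.existsUnique_lift k
    (SuccAlgebra.isSLC (FreeDerPerm.der k Y)) fun y => SuccAlgebra.of _ (FreeDerPerm.of k y)
  obtain ⟨ψ, hψ, -⟩ := FreeSLC.existsUnique_lift k hA fun y : Y => s y.down
  let ρ := FreeNonUnitalNonAssocAlgebra.lift k fun n => FreeSLC.of k (ULift.up n : Y)
  have hρ : ∀ n, ρ (FreeNonUnitalNonAssocAlgebra.of k n) = FreeSLC.of k (ULift.up n : Y) :=
    fun n => FreeNonUnitalNonAssocAlgebra.lift_of_apply k _ n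
  have h₁ : φ.comp ρ = FreeNonUnitalNonAssocAlgebra.lift k fun n =>
      SuccAlgebra.of (FreeDerPerm.der k Y) (FreeDerPerm.of k (ULift.up n : Y)) := by
    apply FreeNonUnitalNonAssocAlgebra.hom_ext
    intro n
    rw [FreeNonUnitalNonAssocAlgebra.lift_of_apply, NonUnitalAlgHom.comp_apply, hρ, hφ]
  have h₂ : ψ.comp ρ = FreeNonUnitalNonAssocAlgebra.lift k s := by
    apply FreeNonUnitalNonAssocAlgebra.hom_ext
    intro n
    rw [FreeNonUnitalNonAssocAlgebra.lift_of_apply, NonUnitalAlgHom.comp_apply, hρ, hψ]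
  have h₃ : ρ f = 0 := by
    apply FreeSLC.injective_of_map_of φ hφ
    have := hf (FreeDerPerm k Y) (FreeDerPerm.der k Y) fun n =>
      SuccAlgebra.of (FreeDerPerm.der k Y) (FreeDerPerm.of k (ULift.up n : Y))
    rw [← h₁] at this
    rw [map_zero]
    exact this
  rw [← h₂, NonUnitalAlgHom.comp_apply, h₃, map_zero]

theorem isSLC_of_inSuccVariety {A : Type w} [NonUnitalNonAssocRing A] [Module k A]
    [IsScalarTower k A A] [SMulCommClass k A A] (hA : InSuccVariety.{u, v, w} k A) : IsSLC A := by
  let x : ℕ → FreeNonUnitalNonAssocAlgebra k ℕ := FreeNonUnitalNonAssocAlgebra.of k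
  refine ⟨fun a b c => ?_, fun a b c e => ?_, fun a b c e => ?_⟩
  · have := hA (x 0 * (x 1 * x 2) - x 1 * (x 0 * x 2))
      (fun P _ _ _ _ _ d s => by
        simp only [x, map_sub, map_mul, FreeNonUnitalNonAssocAlgebra.lift_of_apply]
        exact sub_eq_zero.2 ((SuccAlgebra.isSLC d).left_comm _ _ _))
      (fun n => [a, b, c].getD n 0)
    simpa [x, FreeNonUnitalNonAssocAlgebra.lift_of_apply, sub_eq_zero] using this
  · have := hA (associator (x 0) (x 1 * x 2) (x 3) - associator (x 0) (x 2) (x 1 * x 3))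
      (fun P _ _ _ _ _ d s => by
        simp only [x, associator, map_sub, map_mul, FreeNonUnitalNonAssocAlgebra.lift_of_apply]
        exact (SuccAlgebra.isSLC d).assoc_mul _ _ _ _)
      (fun n => [a, b, c, e].getD n 0)
    simpa [x, associator, FreeNonUnitalNonAssocAlgebra.lift_of_apply] using this
  · have := hA (associator (x 0) (x 1) (x 2) * x 3 - associator (x 0) (x 2) (x 1) * x 3)
      (fun P _ _ _ _ _ d s => by
        simp only [x, associator, map_sub, map_mul, FreeNonUnitalNonAssocAlgebra.lift_of_apply]
        exact (SuccAlgebra.isSLC d).assoc_symm _ _ _ _)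
      (fun n => [a, b, c, e].getD n 0)
    simpa [x, associator, FreeNonUnitalNonAssocAlgebra.lift_of_apply] using this

theorem exists_bijective_freeSLC (X : Type z) : ∃ e : FreeSLC k X →ₙₐ[k] FreeDerPermSucc k X,
    Function.Bijective e ∧ ∀ x : X, e (FreeSLC.of k x) = FreeDerPermSucc.of k x := by
  obtain ⟨φ, hφ, -⟩ := FreeSLC.existsUnique_lift k
    (SuccAlgebra.isSLC (FreeDerPerm.der k X)) fun x => SuccAlgebra.of _ (FreeDerPerm.of k x)
  have hsucc := SuccAlgebra.isSLC (FreeDerPerm.der k X)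
  have hsub : IsSLC (FreeDerPermSucc k X) :=
    ⟨fun a b c => Subtype.ext (hsucc.left_comm a b c),
      fun a b c e => Subtype.ext (hsucc.assoc_mul a b c e),
      fun a b c e => Subtype.ext (hsucc.assoc_symm a b c e)⟩
  obtain ⟨e, he, -⟩ := FreeSLC.existsUnique_lift k hsub (FreeDerPermSucc.of k)
  refine ⟨e, ⟨?_, ?_⟩, he⟩
  · have := FreeSLC.injective_of_map_of
      ((NonUnitalSubalgebraClass.subtype (FreeDerPermSucc k X)).comp e) fun x => by
        rw [NonUnitalAlgHom.comp_apply, he]; rfl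
    exact fun a b h => this (congrArg Subtype.val h)
  · rintro ⟨a, ha⟩
    have hle : FreeDerPermSucc k X ≤ NonUnitalAlgHom.range
        ((NonUnitalSubalgebraClass.subtype (FreeDerPermSucc k X)).comp e) := by
      refine NonUnitalAlgebra.adjoin_le ?_
      rintro _ ⟨x, rfl⟩
      exact ⟨FreeSLC.of k x, congrArg Subtype.val (he x)⟩
    obtain ⟨b, hb⟩ := hle ha
    exact ⟨b, Subtype.ext hb⟩

end Variety

end DerPerm

theorem mainTheorem1 (k : Type u) [Field k] :
    (∀ (A : Type w) [NonUnitalNonAssocRing A] [Module k A] [IsScalarTower k A A]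
        [SMulCommClass k A A],
        DerPerm.InSuccVariety.{u, v, w} k A ↔ DerPerm.IsSLC A) ∧
      (∀ X : Type z, ∃ e : DerPerm.FreeSLC k X →ₙₐ[k] DerPerm.FreeDerPermSucc k X,
        Function.Bijective e ∧
          ∀ x : X, e (DerPerm.FreeSLC.of k x) = DerPerm.FreeDerPermSucc.of k x) :=
  ⟨fun _ _ _ _ _ => ⟨DerPerm.isSLC_of_inSuccVariety k, DerPerm.inSuccVariety_of_isSLC k⟩,
    DerPerm.exists_bijective_freeSLC k⟩
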